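/- Let $d\ge 1$ be an integer, $\upsilon>0$, and put $\delta=d/\upsilon$. A transmitter sits at the origin of $\mathbb{R}^d$. The legitimate receivers and the eavesdroppers are located at the points of two homogeneous Poisson point processes on $\mathbb{R}^d$ with densities $\lambda_b>0$ and $\lambda_e>0$. Each receiver carries a channel power gain $g$. The gains of the legitimate receivers ($i=k$) and those of the eavesdroppers ($i=e$) are i.i.d., independent of the receivers' locations, with the $\alpha$-$\mu$ density $$f_{g_i}(x)=\frac{\alpha_i x^{\alpha_i\mu_i/2-1}}{2\,\Omega_i^{\alpha_i\mu_i/2}\,\Gamma(\mu_i)}\exp\Bigl(-\bigl(x/\Omega_i\bigr)^{\alpha_i/2}\Bigr),\qquad x>0,$$ where $\alpha_i,\mu_i,\Omega_i>0$ (for example the unit-mean normalization $\Omega_i=\Gamma(\mu_i)/\Gamma(\mu_i+2/\alpha_i)$). The population of legitimate receivers (locations and gains) is independent of the population of eavesdroppers. For a receiver at distance $r$ from the transmitter with gain $g$ let $\xi=r^{\upsilon}/g$. For $k\ge 1$, the $k$-th best legitimate receiver is the one with the $k$-th smallest value of $\xi$ among the legitimate receivers, and this value is denoted by $\xi_k$.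 The best eavesdropper is the one with the smallest value of $\xi$ among the eavesdroppers, denoted by $\xi_e$. Their received signal-to-noise ratios are $\eta_k/\xi_k$ and $\eta_e/\xi_e$, where $\eta_k,\eta_e>0$ are constants, and $\varpi=\eta_k/\eta_e$. The secrecy capacity is $C_s=\bigl[\log_2(1+\eta_k/\xi_k)-\log_2(1+\eta_e/\xi_e)\bigr]^+$. Put $$A_{b1}=\frac{\lambda_b c_d\,\Omega_k^{\delta}\,\Gamma(\mu_k+2\delta/\alpha_k)}{\Gamma(\mu_k)},\qquad A_{e1}=\frac{\lambda_e c_d\,\Omega_e^{\delta}\,\Gamma(\mu_e+2\delta/\alpha_e)}{\Gamma(\mu_e)},\qquad c_d=\frac{\pi^{d/2}}{\Gamma(1+d/2)}.$$ Then for every $k\ge1$ the probability of non-zero secrecy capacity of the $k$-th best legitimate receiver against the best eavesdropper is $$\mathbb{P}(C_s>0)=\mathbb{P}\Bigl(\frac{\eta_k}{\xi_k}>\frac{\eta_e}{\xi_e}\Bigr)=\left(\frac{A_{b1}}{A_{b1}+A_{e1}\,\varpi^{-\delta}}\right)^{k}.$$ -/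

import Mathlib

open MeasureTheory ProbabilityTheory

noncomputable section

namespace SecrecyNetwork

variable {Ω : Type*} [MeasurableSpace Ω]

/-- The number (with multiplicity, possibly infinite) of the random points `X 0, X 1, …` that lie
in the set `B`. -/
def count {E : Type*} (X : ℕ → Ω → E) (B : Set E) (ω : Ω) : ℕ∞ :=
  {n : ℕ | X n ω ∈ B}.encard

/-- The random points `X 0, X 1, …` (listed in an arbitrary order) form a homogeneous Poisson point
process of density `lam` on the `d`-dimensional Euclidean space: the number of points in a Borel set
`B` of finite volume is Poisson with mean `lam * volume B`, and the numbers of points in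
disjoint Borel sets are independent. -/
structure IsHPPP {d : ℕ} (P : Measure Ω) (lam : ℝ) (X : ℕ → Ω → EuclideanSpace ℝ (Fin d)) :
    Prop where
  measurable : ∀ n, Measurable (X n)
  count_law : ∀ B : Set (EuclideanSpace ℝ (Fin d)), MeasurableSet B → volume B ≠ ⊤ →
    ∀ m : ℕ, P {ω | count X B ω = m} =
      poissonMeasure (Real.toNNReal (lam * volume.real B)) {m}
  count_indep : ∀ (m : ℕ) (B : Fin m → Set (EuclideanSpace ℝ (Fin d))),
    (∀ i, MeasurableSet (B i)) → (∀ i, volume (B i) ≠ ⊤) →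
    (∀ i j, i ≠ j → Disjoint (B i) (B j)) →
    iIndepFun (fun i => count X (B i)) P

/-- The density of the channel power gain under `α`-`μ` fading with scale `s`. -/
def alphaMuPDF (α μ s x : ℝ) : ℝ :=
  if 0 < x then
    α * x ^ (α * μ / 2 - 1) / (2 * s ^ (α * μ / 2) * Real.Gamma μ) *
      Real.exp (-((x / s) ^ (α / 2)))
  else 0

/-- The law on `ℝ` with density `alphaMuPDF`. -/
def alphaMuLaw (α μ s : ℝ) : Measure ℝ :=
  volume.withDensity fun x => ENNReal.ofReal (alphaMuPDF α μ s x)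

/-- A random population of receivers: the receiver `n` sits at `X n` and has the channel
power gain `g n`. The locations form a homogeneous Poisson point process, and the gains are i.i.d.
with the `α`-`μ` power-gain law and independent of the locations. -/
structure IsReceiverNetwork {d : ℕ} (P : Measure Ω) (lam α μ s : ℝ)
    (X : ℕ → Ω → EuclideanSpace ℝ (Fin d)) (g : ℕ → Ω → ℝ) : Prop where
  hppp : IsHPPP P lam X
  gain_measurable : ∀ n, Measurable (g n)
  gain_law : ∀ n, P.map (g n) = alphaMuLaw α μ s
  gain_indep : iIndepFun g P
  gain_indep_location : IndepFun (fun ω n => X n ω) (fun ω n => g n ω) P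

/-- The path-loss with fading `ξ = r ^ υ / g` of the receiver `n`, where `r` is its distance from the
transmitter at the origin. -/
def pathLoss {d : ℕ} (υ : ℝ) (X : ℕ → Ω → EuclideanSpace ℝ (Fin d)) (g : ℕ → Ω → ℝ)
    (ω : Ω) (n : ℕ) : ℝ :=
  ‖X n ω‖ ^ υ / g n ω

/-- The `k`-th smallest value (`k = 1` is the smallest) of a sequence `ξ`. -/
def kthSmallest (ξ : ℕ → ℝ) (k : ℕ) : ℝ :=
  sInf {x : ℝ | (k : ℕ∞) ≤ {n : ℕ | ξ n ≤ x}.encard}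

/-- The value `kthSmallest ξ k` is attained and has the right rank as soon as only
finitely many terms of `ξ` lie below each level. -/
theorem kthSmallest_spec (ξ : ℕ → ℝ) (hfin : ∀ x, {n | ξ n ≤ x}.Finite) (k : ℕ) (hk : 1 ≤ k) :
    ∃ n, ξ n = kthSmallest ξ k ∧ {m | ξ m < ξ n}.encard < k ∧
      (k : ℕ∞) ≤ {m | ξ m ≤ ξ n}.encard := by
  -- every level set with at least `k` terms has its maximum among the terms
  have key : ∀ A : Set ℕ, A.Finite → (k : ℕ∞) ≤ A.encard →
      ∃ m ∈ A, (k : ℕ∞) ≤ {j | ξ j ≤ ξ m}.encard := by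
    intro A hA hkA
    have hne : A.Nonempty := by
      rw [Set.nonempty_iff_ne_empty]
      rintro rfl
      simp at hkA
      omega
    obtain ⟨m, hm, hmax⟩ := Set.exists_max_image A ξ hA hne
    exact ⟨m, hm, hkA.trans (Set.encard_le_encard fun j hj => hmax j hj)⟩
  obtain ⟨n₀, -, hn₀⟩ := key (Finset.range k : Set ℕ) (Finset.finite_toSet _)
    (by rw [Set.encard_coe_eq_coe_finsetCard, Finset.card_range])
  obtain ⟨n, ⟨hn, hn'⟩, hmin⟩ := Set.exists_min_image
    {n | ξ n ≤ ξ n₀ ∧ (k : ℕ∞) ≤ {j | ξ j ≤ ξ n}.encard} ξ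
    ((hfin (ξ n₀)).subset fun j hj => hj.1) ⟨n₀, le_rfl, hn₀⟩
  have hmin' : ∀ m, (k : ℕ∞) ≤ {j | ξ j ≤ ξ m}.encard → ξ n ≤ ξ m := by
    intro m hm
    rcases le_total (ξ m) (ξ n₀) with h | h
    · exact hmin m ⟨h, hm⟩
    · exact hn.trans h
  refine ⟨n, ?_, ?_, hn'⟩
  · have : IsLeast {x : ℝ | (k : ℕ∞) ≤ {n : ℕ | ξ n ≤ x}.encard} (ξ n) := by
      refine ⟨hn', fun x hx => ?_⟩
      obtain ⟨m, hm, hm'⟩ := key _ (hfin x) hx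
      exact (hmin' m hm').trans hm
    exact this.csInf_eq.symm
  · by_contra! h
    obtain ⟨m, hm, hm'⟩ := key {m | ξ m < ξ n}
      ((hfin (ξ n)).subset fun j (hj : ξ j < ξ n) => hj.le) h
    exact absurd (hmin' m hm') (not_le.mpr hm)

/-- The received signal-to-noise ratio of the `k`-th best receiver, with transmit
signal-to-noise ratio `η`. -/
def kthBestSNR {d : ℕ} (η υ : ℝ) (X : ℕ → Ω → EuclideanSpace ℝ (Fin d)) (g : ℕ → Ω → ℝ)
    (k : ℕ) (ω : Ω) : ℝ :=
  η / kthSmallest (pathLoss υ X g ω) k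

/-- The secrecy capacity, given the signal-to-noise ratios of the main and the wiretap channel. -/
def secrecyCapacity (γb γe : ℝ) : ℝ :=
  max (Real.logb 2 (1 + γb) - Real.logb 2 (1 + γe)) 0

/-- The volume of the unit ball of the `d`-dimensional Euclidean space. -/
def ballConst (d : ℕ) : ℝ :=
  Real.pi ^ ((d : ℝ) / 2) / Real.Gamma (1 + (d : ℝ) / 2)

/-- The constant `A₀` in the intensity `A₀ x ^ (δ - 1)` of the path-loss process with fading. -/
def A0 (d : ℕ) (δ lam α μ s : ℝ) : ℝ :=
  lam * ballConst d * δ * s ^ δ * Real.Gamma (μ + 2 * δ / α) / Real.Gamma μ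

/-- The constant `A₁ = A₀ / δ`. -/
def A1 (d : ℕ) (δ lam α μ s : ℝ) : ℝ :=
  A0 d δ lam α μ s / δ

end SecrecyNetwork

end

/-! For positive path losses, the `k`-th best receiver beats the best eavesdropper exactly when `ξ_k
< ϖ ξ_e`. Everything rests on the law of the path losses: the number of them in `(-∞, t]`, `t ≥ 0`,
is Poisson with mean `A1 * t ^ δ`. For a gain `y > 0`, the locations with path loss at most `t` form
a ball of volume `c_d (t y) ^ δ`, so the fading enters only through the `δ`-th moment of the gain
(`volume_pathLoss_le`, `lintegral_rpow_alphaMuLaw`).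

Since `ξ_k ≤ t` means that at least `k` path losses are at most `t`, the variable `T = A_b ξ_k ^ δ`
is Erlang of order `k` and `S = A_e ξ_e ^ δ` is standard exponential. They are independent, and the
event becomes `T < c S` with `c = A_b ϖ ^ δ / A_e`. Its probability is `(c / (1 + c)) ^ k`: `k`
unit-rate arrivals must precede an independent exponential clock of rate `1 / c`, and each does so
with probability `c / (1 + c)` by lack of memory. The proof evaluates the corresponding integral
(`integral_exp_neg_mul_poisson_tail`).

The Poisson counts come from the marking theorem (`IsHPPP.measure_count_marked`), proved by Laplace
functionals. Independent Poisson counts give the functional on simple functions, and limits give it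
on all measurable ones. Averaging over the independent marks replaces the test function by minus the
logarithm of a mean, and a multiple of an indicator yields a Poisson Laplace transform, which
determines the law. -/

noncomputable section

namespace SecrecyNetwork

open Filter Topology
open scoped ENNReal NNReal

/-! ### Exponentials on `[0, ∞]`, where every sum converges, and counting variables. -/

section

/-- The function `t ↦ exp (-t)` on `[0, ∞]`. -/
def expNeg (t : ℝ≥0∞) : ℝ≥0∞ := EReal.exp (-(t : EReal))

@[simp] lemma expNeg_zero : expNeg 0 = 1 := by simp [expNeg]

@[simp] lemma expNeg_top : expNeg ⊤ = 0 := by simp [expNeg]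

lemma expNeg_ofReal {t : ℝ} (ht : 0 ≤ t) :
    expNeg (ENNReal.ofReal t) = ENNReal.ofReal (Real.exp (-t)) := by
  rw [expNeg, EReal.coe_ennreal_ofReal, max_eq_left ht, ← EReal.coe_neg, EReal.exp_coe]

lemma expNeg_le_one (t : ℝ≥0∞) : expNeg t ≤ 1 := by
  simpa [expNeg] using EReal.coe_ennreal_nonneg t

lemma continuous_expNeg : Continuous expNeg := by
  unfold expNeg
  exact ENNReal.continuous_exp.comp (continuous_neg.comp continuous_coe_ennreal_ereal)

lemma antitone_expNeg : Antitone expNeg := fun a b h => by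
  simp only [expNeg, EReal.exp_le_exp_iff, EReal.neg_le_neg_iff]
  exact_mod_cast h

lemma expNeg_add (a b : ℝ≥0∞) : expNeg (a + b) = expNeg a * expNeg b := by
  rw [expNeg, EReal.coe_ennreal_add, EReal.neg_add, sub_eq_add_neg, EReal.exp_add] <;> simp [expNeg]

lemma expNeg_sum {ι : Type*} (s : Finset ι) (f : ι → ℝ≥0∞) :
    expNeg (∑ i ∈ s, f i) = ∏ i ∈ s, expNeg (f i) := by
  classical
  induction s using Finset.induction_on with
  | empty => simp
  | insert a s ha ih => rw [Finset.sum_insert ha, Finset.prod_insert ha, expNeg_add, ih]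

lemma tendsto_expNeg_tsum (f : ℕ → ℝ≥0∞) :
    Tendsto (fun n => ∏ i ∈ Finset.range n, expNeg (f i)) atTop (𝓝 (expNeg (∑' i, f i))) := by
  simp_rw [← expNeg_sum]
  exact (continuous_expNeg.tendsto _).comp ENNReal.summable.hasSum.tendsto_sum_nat

/-- The function `t ↦ -log t` from `[0, 1]` to `[0, ∞]`. -/
def negLog (t : ℝ≥0∞) : ℝ≥0∞ := (-(ENNReal.log t)).toENNReal

lemma measurable_negLog : Measurable negLog := by
  unfold negLog
  fun_prop

/-- Turns an infinite product of numbers in `[0, 1]`, zero included, into `expNeg` of a sum, the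
form the Laplace functional accepts. -/
lemma expNeg_negLog {t : ℝ≥0∞} (ht : t ≤ 1) : expNeg (negLog t) = t := by
  have : 0 ≤ -(ENNReal.log t) := by
    rw [EReal.le_neg]
    simpa using ht
  rw [expNeg, negLog, EReal.coe_toENNReal this, neg_neg, ENNReal.exp_log]

variable {Ω : Type*} [MeasurableSpace Ω]

/-- A set has at least `k` elements iff it contains a finset with `k` elements. -/
lemma natCast_le_encard_iff {A : Set ℕ} {k : ℕ} :
    (k : ℕ∞) ≤ A.encard ↔ ∃ s : Finset ℕ, s.card = k ∧ ∀ n ∈ s, n ∈ A := by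
  constructor
  · intro h
    obtain ⟨t, ht, htk⟩ := Set.exists_subset_encard_eq h
    have hf : t.Finite := Set.finite_of_encard_eq_coe htk
    refine ⟨hf.toFinset, ?_, fun n hn => ht (by simpa using hn)⟩
    rw [hf.encard_eq_coe_toFinset_card] at htk
    exact_mod_cast htk
  · rintro ⟨s, rfl, hs⟩
    rw [← Set.encard_coe_eq_coe_finsetCard]
    exact Set.encard_le_encard fun n hn => hs n (by simpa using hn)

lemma measurable_of_natCast_le {f : Ω → ℕ∞} (h : ∀ k : ℕ, MeasurableSet {ω | (k : ℕ∞) ≤ f ω}) :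
    Measurable f := by
  have hm : ∀ k : ℕ, MeasurableSet (f ⁻¹' {(k : ℕ∞)}) := by
    intro k
    have : f ⁻¹' {(k : ℕ∞)} = {ω | (k : ℕ∞) ≤ f ω} \ {ω | ((k + 1 : ℕ) : ℕ∞) ≤ f ω} := by
      ext ω
      simp only [Set.mem_preimage, Set.mem_singleton_iff, Set.mem_sdiff, Set.mem_ofPred_eq]
      constructor
      · intro h
        rw [h]
        exact ⟨le_rfl, by norm_cast; omega⟩
      · rintro ⟨h1, h2⟩
        refine le_antisymm ?_ h1
        push Not at h2
        exact ENat.lt_add_one_iff (by simp) |>.1 (by exact_mod_cast h2)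
    rw [this]
    exact (h k).diff (h (k + 1))
  refine measurable_to_countable' fun x => ?_
  induction x using ENat.recTopCoe with
  | coe k => exact hm k
  | top =>
    have : f ⁻¹' {⊤} = (⋃ k : ℕ, f ⁻¹' {(k : ℕ∞)})ᶜ := by
      ext ω
      simp only [Set.mem_preimage, Set.mem_singleton_iff, Set.mem_compl_iff, Set.mem_iUnion]
      constructor
      · rintro h ⟨k, hk⟩
        simp [h] at hk
      · intro h
        by_contra h'
        exact h ⟨_, (ENat.natCast_toNat h').symm⟩
    rw [this]
    exact (MeasurableSet.iUnion hm).compl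

lemma measurable_encard_setOf {A : ℕ → Set Ω} (hA : ∀ n, MeasurableSet (A n)) :
    Measurable fun ω => {n | ω ∈ A n}.encard := by
  refine measurable_of_natCast_le fun k => ?_
  have : {ω | (k : ℕ∞) ≤ {n | ω ∈ A n}.encard} =
      ⋃ s : Finset ℕ, ⋃ _ : s.card = k, ⋂ n ∈ s, A n := by
    ext ω
    simp [natCast_le_encard_iff]
  rw [this]
  exact MeasurableSet.iUnion fun s => MeasurableSet.iUnion fun _ =>
    Finset.measurableSet_biInter _ fun n _ => hA n

lemma measurable_count {E : Type*} [MeasurableSpace E] {X : ℕ → Ω → E} (hX : ∀ n, Measurable (X n))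
    {B : Set E} (hB : MeasurableSet B) : Measurable (count X B) :=
  measurable_encard_setOf fun n => hX n hB

/-- A law on `ℕ∞` that gives each natural number the mass of a law on `ℕ` is that law. -/
lemma map_eq_of_measure_natCast {P : Measure Ω} [IsProbabilityMeasure P] {N : Ω → ℕ∞}
    (hN : Measurable N) {ν : Measure ℕ} [IsProbabilityMeasure ν]
    (h : ∀ m : ℕ, P {ω | N ω = m} = ν {m}) : P.map N = ν.map (fun m : ℕ => (m : ℕ∞)) := by
  have : IsProbabilityMeasure (P.map N) := Measure.isProbabilityMeasure_map hN.aemeasurable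
  have hc : Measurable (fun m : ℕ => (m : ℕ∞)) := measurable_of_countable _
  have : IsProbabilityMeasure (ν.map (fun m : ℕ => (m : ℕ∞))) :=
    Measure.isProbabilityMeasure_map hc.aemeasurable
  have hfin : ∀ m : ℕ, P.map N {(m : ℕ∞)} = ν.map (fun m : ℕ => (m : ℕ∞)) {(m : ℕ∞)} := by
    intro m
    rw [Measure.map_apply hN (measurableSet_singleton _),
      Measure.map_apply hc (measurableSet_singleton _)]
    have hm : (fun m : ℕ => (m : ℕ∞)) ⁻¹' {(m : ℕ∞)} = {m} := by
      ext j
      simp [Nat.cast_inj]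
    rw [hm, ← h m]
    rfl
  -- Agreement on the naturals fixes the mass at `⊤`, since both total masses are one.
  have hU : P.map N (Set.range (fun m : ℕ => (m : ℕ∞))) =
      ν.map (fun m : ℕ => (m : ℕ∞)) (Set.range (fun m : ℕ => (m : ℕ∞))) := by
    have hd : Pairwise (Function.onFun Disjoint fun m : ℕ => ({(m : ℕ∞)} : Set ℕ∞)) := by
      intro i j hij
      simpa [Function.onFun] using hij
    rw [← Set.iUnion_singleton_eq_range, measure_iUnion hd fun _ => measurableSet_singleton _,
      measure_iUnion hd fun _ => measurableSet_singleton _]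
    simp_rw [hfin]
  refine Measure.ext_of_singleton fun x => ?_
  induction x using ENat.recTopCoe with
  | coe m => exact hfin m
  | top =>
    have : ({⊤} : Set ℕ∞) = (Set.range (fun m : ℕ => (m : ℕ∞)))ᶜ := by
      ext x
      induction x using ENat.recTopCoe <;> simp
    rw [this, prob_compl_eq_one_sub (Set.to_countable _).measurableSet,
      prob_compl_eq_one_sub (Set.to_countable _).measurableSet, hU]

lemma lintegral_expNeg_mul_poissonMeasure {a : ℝ≥0∞} (ha : a ≠ ⊤) (r : ℝ≥0) :
    ∫⁻ m, expNeg (a * (m : ℝ≥0∞)) ∂(poissonMeasure r) = expNeg (r * (1 - expNeg a)) := by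
  lift a to ℝ≥0 using ha
  have ha0 : (0 : ℝ) ≤ a := a.2
  have hE : expNeg a = ENNReal.ofReal (Real.exp (-a)) := by
    rw [← expNeg_ofReal ha0, ENNReal.ofReal_coe_nnreal]
  have h1 : Real.exp (-(a : ℝ)) ≤ 1 := by simp
  have hR : (r : ℝ≥0∞) * (1 - expNeg a) = ENNReal.ofReal ((r : ℝ) * (1 - Real.exp (-a))) := by
    rw [hE, ENNReal.ofReal_mul r.coe_nonneg, ENNReal.ofReal_sub _ (Real.exp_pos _).le, ENNReal.ofReal_one,
      ENNReal.ofReal_coe_nnreal]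
  rw [hR, expNeg_ofReal (mul_nonneg r.coe_nonneg (by linarith)), lintegral_countable']
  have hs : HasSum (fun m : ℕ => Real.exp (-r) * ((r * Real.exp (-a)) ^ m / (m.factorial : ℝ)))
      (Real.exp (-r) * Real.exp (r * Real.exp (-a))) := by
    refine HasSum.mul_left _ ?_
    rw [Real.exp_eq_exp_ℝ]
    exact NormedSpace.expSeries_div_hasSum_exp (𝔸 := ℝ) _
  have hterm : ∀ m : ℕ, expNeg (a * (m : ℝ≥0∞)) * poissonMeasure r {m} =
      ENNReal.ofReal (Real.exp (-r) * ((r * Real.exp (-a)) ^ m / (m.factorial : ℝ))) := by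
    intro m
    have : (a : ℝ≥0∞) * (m : ℝ≥0∞) = ENNReal.ofReal (a * m) := by
      rw [ENNReal.ofReal_mul ha0]; simp
    rw [this, expNeg_ofReal (by positivity), poissonMeasure_singleton,
      ← ENNReal.ofReal_mul (Real.exp_pos _).le]
    congr 1
    rw [mul_pow, ← Real.exp_nat_mul]
    ring_nf
  simp_rw [hterm]
  rw [← ENNReal.ofReal_tsum_of_nonneg (fun m => by positivity) hs.summable, hs.tsum_eq,
    ← Real.exp_add]
  ring_nf

end

/-! ### Laplace functionals of Poisson processes, without and with marks. -/

section

lemma tsum_indicator_const_eq_count {Ω E : Type*} (X : ℕ → Ω → E) (B : Set E) (c : ℝ≥0∞) (ω : Ω) :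
    ∑' n, B.indicator (fun _ => c) (X n ω) = c * (count X B ω : ℝ≥0∞) := by
  have : ∀ n, B.indicator (fun _ => c) (X n ω) = {n | X n ω ∈ B}.indicator (fun _ => c) n := by
    intro n
    simp [Set.indicator]
  simp_rw [this]
  rw [← tsum_subtype, ENNReal.tsum_set_const, mul_comm, count]

/-- The value `0` is left out because its level set may have infinite volume. A general `F` serves
both sides of the Laplace functional: the identity and `1 - expNeg`. -/
lemma simpleFunc_eq_sum_indicator {E : Type*} [MeasurableSpace E] (f : SimpleFunc E ℝ≥0∞)
    (F : ℝ≥0∞ → ℝ≥0∞) (hF : F 0 = 0) (x : E) :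
    F (f x) = ∑ y ∈ f.range.filter (· ≠ 0), (f ⁻¹' {y}).indicator (fun _ => F y) x := by
  by_cases h0 : f x = 0
  · rw [h0, hF, Finset.sum_eq_zero]
    intro y hy
    rw [Set.indicator_of_notMem]
    intro hx
    exact (Finset.mem_filter.1 hy).2 (by simpa [h0] using hx.symm)
  · rw [Finset.sum_eq_single (f x)]
    · simp
    · intro y _ hy
      exact Set.indicator_of_notMem (fun hx => hy (by simpa using hx.symm)) _
    · intro h
      exact absurd (Finset.mem_filter.2 ⟨SimpleFunc.mem_range_self f x, h0⟩) h

variable {Ω : Type*} [MeasurableSpace Ω] {P : Measure Ω} [IsProbabilityMeasure P] {d : ℕ} {lam : ℝ}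
  {X : ℕ → Ω → EuclideanSpace ℝ (Fin d)}

lemma IsHPPP.lintegral_expNeg_mul_count (hX : IsHPPP P lam X)
    {B : Set (EuclideanSpace ℝ (Fin d))} (hB : MeasurableSet B) (hBv : volume B ≠ ⊤)
    {a : ℝ≥0∞} (ha : a ≠ ⊤) :
    ∫⁻ ω, expNeg (a * (count X B ω : ℝ≥0∞)) ∂P =
      expNeg (ENNReal.ofReal lam * ((1 - expNeg a) * volume B)) := by
  have hm := measurable_count hX.measurable hB
  have h := map_eq_of_measure_natCast hm (hX.count_law B hB hBv)
  have h1 : ∫⁻ ω, expNeg (a * (count X B ω : ℝ≥0∞)) ∂P =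
      ∫⁻ x : ℕ∞, expNeg (a * (x : ℝ≥0∞)) ∂(P.map (count X B)) := by
    rw [lintegral_map (measurable_of_countable _) hm]
  rw [h1, h, lintegral_map (measurable_of_countable _) (measurable_of_countable _)]
  have h2 := lintegral_expNeg_mul_poissonMeasure ha (Real.toNNReal (lam * volume.real B))
  simp only [ENat.toENNReal_coe]
  rw [h2]
  congr 1
  have : ((Real.toNNReal (lam * volume.real B) : ℝ≥0) : ℝ≥0∞) = ENNReal.ofReal lam * volume B := by
    rw [← ENNReal.ofReal, ENNReal.ofReal_mul' measureReal_nonneg, ofReal_measureReal hBv]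
  rw [this]
  ring

/-- The sum over the points is a finite combination of counts in disjoint level sets, so
independence factors the expectation into Poisson transforms. -/
lemma IsHPPP.lintegral_expNeg_tsum_simpleFunc (hX : IsHPPP P lam X)
    (f : SimpleFunc (EuclideanSpace ℝ (Fin d)) ℝ≥0∞) (hf : ∀ x, f x ≠ ⊤)
    (hs : f.FinMeasSupp volume) :
    ∫⁻ ω, expNeg (∑' n, f (X n ω)) ∂P =
      expNeg (ENNReal.ofReal lam * ∫⁻ x, (1 - expNeg (f x))) := by
  set R := f.range.filter (· ≠ 0) with hR
  let b : Fin R.card → ℝ≥0∞ := fun i => R.equivFin.symm i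
  have hbR : ∀ i, b i ∈ R := fun i => (R.equivFin.symm i).2
  have hsum : ∀ G : ℝ≥0∞ → ℝ≥0∞, ∑ y ∈ R, G y = ∑ i, G (b i) := by
    intro G
    rw [← Finset.sum_coe_sort]
    exact (Equiv.sum_comp R.equivFin.symm fun y : R => G y).symm
  have hb0 : ∀ i, b i ≠ 0 := fun i => (Finset.mem_filter.1 (hbR i)).2
  have hbt : ∀ i, b i ≠ ⊤ := fun i => by
    obtain ⟨x, hx⟩ := SimpleFunc.mem_range.1 (Finset.mem_filter.1 (hbR i)).1
    rw [← hx]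
    exact hf x
  have hBm : ∀ i, MeasurableSet (f ⁻¹' {b i}) := fun i => f.measurableSet_fiber _
  have hBv : ∀ i, volume (f ⁻¹' {b i}) ≠ ⊤ := fun i => (hs.meas_preimage_singleton_ne_zero (hb0 i)).ne
  have hdisj : ∀ i j, i ≠ j → Disjoint (f ⁻¹' {b i}) (f ⁻¹' {b j}) := by
    intro i j hij
    refine Disjoint.preimage _ ?_
    rw [Set.disjoint_singleton]
    intro h
    exact hij (R.equivFin.symm.injective (Subtype.ext h))
  have hind := hX.count_indep R.card (fun i => f ⁻¹' {b i}) hBm hBv hdisj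
  have h1 : ∀ ω, expNeg (∑' n, f (X n ω)) =
      ∏ i, expNeg (b i * (count X (f ⁻¹' {b i}) ω : ℝ≥0∞)) := by
    intro ω
    have : ∀ n, f (X n ω) = ∑ i, (f ⁻¹' {b i}).indicator (fun _ => b i) (X n ω) := by
      intro n
      rw [← hsum fun y => (f ⁻¹' {y}).indicator (fun _ => y) (X n ω)]
      exact simpleFunc_eq_sum_indicator f id rfl _
    simp_rw [this]
    rw [Summable.tsum_finsetSum (fun _ _ => ENNReal.summable), expNeg_sum]
    simp_rw [tsum_indicator_const_eq_count]
  simp_rw [h1]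
  have hind' := hind.comp (fun i (x : ℕ∞) => expNeg (b i * (x : ℝ≥0∞)))
    fun i => measurable_of_countable _
  have h2 := lintegral_prod_eq_prod_lintegral_of_indepFun Finset.univ _ hind' fun i =>
    (measurable_of_countable _).comp (measurable_count hX.measurable (hBm i))
  simp only [Function.comp_apply] at h2
  rw [h2]
  simp_rw [hX.lintegral_expNeg_mul_count (hBm _) (hBv _) (hbt _)]
  rw [← expNeg_sum, ← Finset.mul_sum]
  congr 2
  have : ∀ x, 1 - expNeg (f x) =
      ∑ i, (f ⁻¹' {b i}).indicator (fun _ => 1 - expNeg (b i)) x := by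
    intro x
    rw [← hsum fun y => (f ⁻¹' {y}).indicator (fun _ => 1 - expNeg y) x]
    exact simpleFunc_eq_sum_indicator f (fun y => 1 - expNeg y) (by simp) _
  simp_rw [this]
  rw [lintegral_finsetSum _ fun i _ => measurable_const.indicator (hBm i)]
  simp_rw [lintegral_indicator_const (hBm _)]

/-- The Laplace functional of a homogeneous Poisson point process. -/
theorem IsHPPP.lintegral_expNeg_tsum (hX : IsHPPP P lam X)
    {h : EuclideanSpace ℝ (Fin d) → ℝ≥0∞} (hh : Measurable h) :
    ∫⁻ ω, expNeg (∑' n, h (X n ω)) ∂P =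
      expNeg (ENNReal.ofReal lam * ∫⁻ x, (1 - expNeg (h x))) := by
  -- Restriction to growing balls gives the approximants support of finite volume and keeps them
  -- increasing.
  let f : ℕ → SimpleFunc (EuclideanSpace ℝ (Fin d)) ℝ≥0∞ := fun j =>
    (SimpleFunc.eapprox h j).restrict (Metric.ball 0 j)
  have hfa : ∀ j x, f j x = (Metric.ball 0 (j : ℝ)).indicator (SimpleFunc.eapprox h j) x :=
    fun j x => SimpleFunc.restrict_apply _ Metric.isOpen_ball.measurableSet _
  have hmono : ∀ x, Monotone fun j => f j x := by
    intro x i j hij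
    simp only [hfa]
    refine (Set.indicator_le_indicator_of_subset (Metric.ball_subset_ball (by exact_mod_cast hij))
      (fun _ => zero_le) x).trans (Set.indicator_le_indicator ?_)
    exact SimpleFunc.monotone_eapprox h hij x
  have hlim : ∀ x, Tendsto (fun j => f j x) atTop (𝓝 (h x)) := by
    intro x
    refine (SimpleFunc.tendsto_eapprox hh x).congr' ?_
    obtain ⟨N, hN⟩ := exists_nat_gt ‖x‖
    filter_upwards [eventually_ge_atTop N] with j hj
    rw [hfa, Set.indicator_of_mem]
    simpa using hN.trans_le (by exact_mod_cast hj)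
  have hlt : ∀ j x, f j x ≠ ⊤ := by
    intro j x
    rw [hfa]
    exact ((Set.indicator_le_self _ _ _).trans_lt (SimpleFunc.eapprox_lt_top h j x)).ne
  have hsupp : ∀ j, (f j).FinMeasSupp volume := by
    intro j
    rw [SimpleFunc.finMeasSupp_iff_support]
    refine (measure_mono ?_).trans_lt (Metric.isBounded_ball (x := 0) (r := (j : ℝ))).measure_lt_top
    intro x hx
    by_contra hx'
    exact hx (by rw [hfa, Set.indicator_of_notMem hx'])
  -- Monotone convergence for the counting measure on the indices.
  have htsum : ∀ ω, Tendsto (fun j => ∑' n, f j (X n ω)) atTop (𝓝 (∑' n, h (X n ω))) := by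
    intro ω
    simp_rw [← lintegral_count]
    exact lintegral_tendsto_of_tendsto_of_monotone (fun j => (measurable_of_countable _).aemeasurable)
      (ae_of_all _ fun n => hmono _) (ae_of_all _ fun n => hlim _)
  have hL : Tendsto (fun j => ∫⁻ ω, expNeg (∑' n, f j (X n ω)) ∂P) atTop
      (𝓝 (∫⁻ ω, expNeg (∑' n, h (X n ω)) ∂P)) := by
    refine tendsto_lintegral_of_dominated_convergence (fun _ => 1) (fun j => ?_)
      (fun j => ae_of_all _ fun ω => expNeg_le_one _) (by simp)
      (ae_of_all _ fun ω => (continuous_expNeg.tendsto _).comp (htsum ω))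
    exact continuous_expNeg.measurable.comp
      (Measurable.tsum fun n => (f j).measurable.comp (hX.measurable n))
  have hRt : Tendsto (fun j => expNeg (ENNReal.ofReal lam * ∫⁻ x, (1 - expNeg (f j x)))) atTop
      (𝓝 (expNeg (ENNReal.ofReal lam * ∫⁻ x, (1 - expNeg (h x))))) := by
    refine (continuous_expNeg.tendsto _).comp
      (ENNReal.Tendsto.const_mul ?_ (Or.inr ENNReal.ofReal_ne_top))
    refine lintegral_tendsto_of_tendsto_of_monotone (fun j => ?_)
      (ae_of_all _ fun x i j hij => tsub_le_tsub_left (antitone_expNeg (hmono x hij)) _)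
      (ae_of_all _ fun x => ?_)
    · exact (measurable_const.sub
        (continuous_expNeg.measurable.comp (f j).measurable)).aemeasurable
    · exact ((ENNReal.continuous_sub_left ENNReal.one_ne_top).tendsto _).comp
        ((continuous_expNeg.tendsto _).comp (hlim x))
  refine tendsto_nhds_unique hL (hRt.congr fun j => ?_)
  exact (hX.lintegral_expNeg_tsum_simpleFunc (f j) (hlt j) (hsupp j)).symm

/-- The Laplace functional of a homogeneous Poisson point process with independent marks. -/
theorem IsHPPP.lintegral_expNeg_tsum_marked (hX : IsHPPP P lam X) {S : Type*} [MeasurableSpace S]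
    {g : ℕ → Ω → S} (hg : ∀ n, Measurable (g n)) {G : Measure S} (hG : ∀ n, P.map (g n) = G)
    (hgi : iIndepFun g P) (hXg : IndepFun (fun ω n => X n ω) (fun ω n => g n ω) P)
    {φ : EuclideanSpace ℝ (Fin d) × S → ℝ≥0∞} (hφ : Measurable φ) :
    ∫⁻ ω, expNeg (∑' n, φ (X n ω, g n ω)) ∂P =
      expNeg (ENNReal.ofReal lam * ∫⁻ x, (1 - ∫⁻ y, expNeg (φ (x, y)) ∂G)) := by
  have hGp : IsProbabilityMeasure G := by
    rw [← hG 0]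
    exact Measure.isProbabilityMeasure_map (hg 0).aemeasurable
  have hXm : Measurable fun ω n => X n ω := measurable_pi_lambda _ hX.measurable
  have hgm : Measurable fun ω n => g n ω := measurable_pi_lambda _ hg
  have : IsProbabilityMeasure (P.map fun ω n => X n ω) :=
    Measure.isProbabilityMeasure_map hXm.aemeasurable
  have : IsProbabilityMeasure (P.map fun ω n => g n ω) :=
    Measure.isProbabilityMeasure_map hgm.aemeasurable
  set ψ : EuclideanSpace ℝ (Fin d) → ℝ≥0∞ := fun x => ∫⁻ y, expNeg (φ (x, y)) ∂G with hψ
  have hEφ : Measurable fun p => expNeg (φ p) := continuous_expNeg.measurable.comp hφ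
  have hψm : Measurable ψ := hEφ.lintegral_prod_right'
  have hψ1 : ∀ x, ψ x ≤ 1 := fun x => by
    calc ψ x ≤ ∫⁻ _, 1 ∂G := lintegral_mono fun y => expNeg_le_one _
      _ = 1 := by simp
  let Φ : (ℕ → EuclideanSpace ℝ (Fin d)) × (ℕ → S) → ℝ≥0∞ := fun p =>
    expNeg (∑' n, φ (p.1 n, p.2 n))
  have hΦ : Measurable Φ := continuous_expNeg.measurable.comp
    (Measurable.tsum fun n => hφ.comp (by fun_prop))
  -- With the locations frozen, independence of the marks turns the expected product into the
  -- product of the means `ψ (x n)`.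
  have hmarks : ∀ x : ℕ → EuclideanSpace ℝ (Fin d),
      ∫⁻ ω, expNeg (∑' n, φ (x n, g n ω)) ∂P = expNeg (∑' n, negLog (ψ (x n))) := by
    intro x
    have h1 : Tendsto (fun n => ∫⁻ ω, ∏ i ∈ Finset.range n, expNeg (φ (x i, g i ω)) ∂P) atTop
        (𝓝 (∫⁻ ω, expNeg (∑' n, φ (x n, g n ω)) ∂P)) := by
      refine tendsto_lintegral_of_dominated_convergence (fun _ => 1) (fun j => ?_)
        (fun j => ae_of_all _ fun ω => Finset.prod_le_one' fun i _ => expNeg_le_one _) (by simp)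
        (ae_of_all _ fun ω => tendsto_expNeg_tsum _)
      exact Finset.measurable_fun_prod _ fun i _ =>
        hEφ.comp (measurable_const.prodMk (hg i))
    refine tendsto_nhds_unique h1 ((tendsto_expNeg_tsum fun n => negLog (ψ (x n))).congr fun n => ?_)
    have hm : ∀ i, Measurable fun y => expNeg (φ (x i, y)) := fun i =>
      hEφ.comp (measurable_const.prodMk measurable_id)
    have h2 := lintegral_prod_eq_prod_lintegral_of_indepFun (Finset.range n) _
      (hgi.comp (fun i y => expNeg (φ (x i, y))) hm) fun i => (hm i).comp (hg i)
    simp only [Function.comp_apply] at h2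
    rw [h2]
    refine Finset.prod_congr rfl fun i _ => ?_
    rw [expNeg_negLog (hψ1 _), ← lintegral_map (hm i) (hg i), hG i]
  have hjoint := (indepFun_iff_map_prod_eq_prod_map_map hXm.aemeasurable hgm.aemeasurable).1 hXg
  calc ∫⁻ ω, expNeg (∑' n, φ (X n ω, g n ω)) ∂P
      = ∫⁻ p, Φ p ∂(P.map fun ω => (fun n => X n ω, fun n => g n ω)) := by
        rw [lintegral_map hΦ (hXm.prodMk hgm)]
    _ = ∫⁻ x, ∫⁻ y, Φ (x, y) ∂(P.map fun ω n => g n ω) ∂(P.map fun ω n => X n ω) := by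
        rw [hjoint, lintegral_prod _ hΦ.aemeasurable]
    _ = ∫⁻ ω, expNeg (∑' n, negLog (ψ (X n ω))) ∂P := by
        rw [lintegral_map hΦ.lintegral_prod_right' hXm]
        refine lintegral_congr fun ω => ?_
        have hΦx : Measurable fun y => Φ (fun n => X n ω, y) :=
          hΦ.comp (measurable_const.prodMk measurable_id)
        rw [lintegral_map hΦx hgm]
        exact hmarks _
    _ = _ := by
        have h := hX.lintegral_expNeg_tsum (measurable_negLog.comp hψm)
        simp_rw [Function.comp_apply, expNeg_negLog (hψ1 _)] at h
        exact h

end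

/-! ### Identification of Poisson laws, the marking theorem, moments of the gains. -/

section

/-- A bounded sequence of coefficients is determined by its generating function on `(0, 1)`. -/
lemma coeff_eq_of_hasSum_Ioo {p q : ℕ → ℝ} {F : ℝ → ℝ}
    (hp : ∀ z, |z| < 1 → Summable fun n => z ^ n * p n)
    (hq : ∀ z, |z| < 1 → Summable fun n => z ^ n * q n)
    (hpF : ∀ z, 0 < z → z < 1 → HasSum (fun n => z ^ n * p n) (F z))
    (hqF : ∀ z, 0 < z → z < 1 → HasSum (fun n => z ^ n * q n) (F z)) : p = q := by
  have key : ∀ p : ℕ → ℝ, (∀ z, |z| < 1 → Summable fun n => z ^ n * p n) →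
      HasFPowerSeriesAt (fun z => ∑' n, z ^ n * p n) (FormalMultilinearSeries.ofScalars ℝ p) 0 := by
    intro p hp
    rw [hasFPowerSeriesAt_iff]
    filter_upwards [Metric.ball_mem_nhds (0 : ℝ) one_pos] with z hz
    simp only [FormalMultilinearSeries.coeff_ofScalars, smul_eq_mul, zero_add]
    exact (hp z (by simpa using hz)).hasSum
  have h1 := key p hp
  have h2 := key q hq
  -- Identity theorem: two functions analytic at `0` agree on `(0, 1)`, which accumulates at `0`.
  have hev : ∀ᶠ z in 𝓝 (0 : ℝ), ∑' n, z ^ n * p n = ∑' n, z ^ n * q n := by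
    rw [← h1.analyticAt.frequently_eq_iff_eventually_eq h2.analyticAt]
    have : ∀ᶠ z in 𝓝[>] (0 : ℝ), ∑' n, z ^ n * p n = ∑' n, z ^ n * q n := by
      filter_upwards [Ioo_mem_nhdsGT (one_pos (α := ℝ))] with z hz
      rw [(hpF z hz.1 hz.2).tsum_eq, (hqF z hz.1 hz.2).tsum_eq]
    exact this.frequently.filter_mono (nhdsWithin_mono _ fun z hz => ne_of_gt hz)
  have := h1.eq_formalMultilinearSeries_of_eventually h2 hev
  ext n
  simpa [FormalMultilinearSeries.coeff_ofScalars] using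
    congrArg (fun s : FormalMultilinearSeries ℝ ℝ ℝ => s.coeff n) this

variable {Ω : Type*} [MeasurableSpace Ω] {P : Measure Ω} [IsProbabilityMeasure P]

/-- With `a = -log z > 0`, `exp (-a N)` is `z ^ N` for finite `N` and vanishes at `N = ⊤`, so the
Laplace transform is the generating function of the finite masses. -/
lemma hasSum_pow_mul_measureReal_eq {N : Ω → ℕ∞} (hN : Measurable N) {z : ℝ} (hz : 0 < z)
    (hz1 : z < 1) :
    HasSum (fun m : ℕ => z ^ m * P.real {ω | N ω = m})
      (∫⁻ ω, expNeg (ENNReal.ofReal (-Real.log z) * (N ω : ℝ≥0∞)) ∂P).toReal := by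
  have hl : 0 < -Real.log z := by linarith [Real.log_neg hz hz1]
  have hpow : ∀ m : ℕ, expNeg (ENNReal.ofReal (-Real.log z) * ((m : ℕ∞) : ℝ≥0∞)) =
      ENNReal.ofReal (z ^ m) := by
    intro m
    rw [ENat.toENNReal_coe, ← ENNReal.ofReal_natCast, ← ENNReal.ofReal_mul hl.le,
      expNeg_ofReal (by positivity), ← Real.exp_log (pow_pos hz m), Real.log_pow]
    ring_nf
  have h1 : ∀ ω, expNeg (ENNReal.ofReal (-Real.log z) * (N ω : ℝ≥0∞)) =
      ∑' m : ℕ, {ω | N ω = m}.indicator (fun _ => ENNReal.ofReal (z ^ m)) ω := by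
    intro ω
    generalize hn : N ω = x
    induction x using ENat.recTopCoe with
    | top =>
      have : ENNReal.ofReal (-Real.log z) ≠ 0 := by simpa using hl
      simp [hn, ENNReal.mul_top this]
    | coe k =>
      rw [hpow, tsum_eq_single k]
      · simp [hn]
      · intro m hm
        refine Set.indicator_of_notMem (fun h => hm ?_) _
        have h : N ω = m := h
        rw [hn] at h
        exact_mod_cast h.symm
  have hms : ∀ m : ℕ, MeasurableSet {ω | N ω = m} := fun m => hN (measurableSet_singleton _)
  have h2 : ∫⁻ ω, expNeg (ENNReal.ofReal (-Real.log z) * (N ω : ℝ≥0∞)) ∂P =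
      ∑' m : ℕ, ENNReal.ofReal (z ^ m * P.real {ω | N ω = m}) := by
    simp_rw [h1]
    rw [lintegral_tsum fun m => (measurable_const.indicator (hms m)).aemeasurable]
    refine tsum_congr fun m => ?_
    rw [lintegral_indicator_const (hms m), ENNReal.ofReal_mul (by positivity), ofReal_measureReal]
  have hfin : ∑' m : ℕ, ENNReal.ofReal (z ^ m * P.real {ω | N ω = m}) ≠ ⊤ := by
    rw [← h2]
    refine ne_top_of_le_ne_top ENNReal.one_ne_top ?_
    calc _ ≤ ∫⁻ _, 1 ∂P := lintegral_mono fun ω => expNeg_le_one _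
      _ = 1 := by simp
  rw [h2, ENNReal.tsum_toReal_eq fun m => ENNReal.ofReal_ne_top]
  have h3 : ∀ m : ℕ, (ENNReal.ofReal (z ^ m * P.real {ω | N ω = m})).toReal =
      z ^ m * P.real {ω | N ω = m} := fun m => ENNReal.toReal_ofReal (by positivity)
  have h4 := (ENNReal.summable_toReal hfin).hasSum
  simp_rw [h3] at h4 ⊢
  exact h4

lemma summable_pow_mul_of_abs_coeff_le_one {p : ℕ → ℝ} (hp : ∀ n, |p n| ≤ 1) {z : ℝ} (hz : |z| < 1) :
    Summable fun n => z ^ n * p n := by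
  refine Summable.of_norm_bounded (summable_geometric_of_lt_one (abs_nonneg z) hz) fun n => ?_
  rw [Real.norm_eq_abs, abs_mul, abs_pow]
  exact mul_le_of_le_one_right (by positivity) (hp n)

/-- A random variable with values in `ℕ∞` whose Laplace transform is that of a Poisson law has this
Poisson law. -/
lemma measure_eq_poissonMeasure_of_lintegral_expNeg {N : Ω → ℕ∞} (hN : Measurable N) (r : ℝ≥0)
    (h : ∀ a : ℝ≥0∞, a ≠ ⊤ →
      ∫⁻ ω, expNeg (a * (N ω : ℝ≥0∞)) ∂P = expNeg (r * (1 - expNeg a))) (m : ℕ) :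
    P.real {ω | N ω = m} = (poissonMeasure r).real {m} := by
  have hc : Measurable (fun m : ℕ => (m : ℕ∞)) := measurable_of_countable _
  have hν : ∀ m : ℕ, {j : ℕ | (j : ℕ∞) = m} = {m} := by
    intro m; ext j; simp [Nat.cast_inj]
  refine congrFun (coeff_eq_of_hasSum_Ioo (p := fun m : ℕ => P.real {ω | N ω = m})
    (q := fun m => (poissonMeasure r).real {m})
    (F := fun z => (expNeg (r * (1 - expNeg (ENNReal.ofReal (-Real.log z))))).toReal)
    (fun z hz => summable_pow_mul_of_abs_coeff_le_one (fun n => ?_) hz)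
    (fun z hz => summable_pow_mul_of_abs_coeff_le_one (fun n => ?_) hz)
    (fun z hz hz1 => ?_) (fun z hz hz1 => ?_)) m
  · rw [abs_of_nonneg measureReal_nonneg]
    exact measureReal_le_one
  · rw [abs_of_nonneg measureReal_nonneg]
    exact measureReal_le_one
  · rw [← h _ ENNReal.ofReal_ne_top]
    exact hasSum_pow_mul_measureReal_eq hN hz hz1
  · have := hasSum_pow_mul_measureReal_eq (P := poissonMeasure r) hc hz hz1
    simp only [ENat.toENNReal_coe] at this
    rw [lintegral_expNeg_mul_poissonMeasure ENNReal.ofReal_ne_top] at this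
    simpa only [hν] using this

/-- The marking theorem: the number of marked points in a set `D` of finite intensity is Poisson. -/
theorem IsHPPP.measure_count_marked {d : ℕ} {lam : ℝ} {X : ℕ → Ω → EuclideanSpace ℝ (Fin d)}
    (hX : IsHPPP P lam X) {S : Type*} [MeasurableSpace S]
    {g : ℕ → Ω → S} (hg : ∀ n, Measurable (g n)) {G : Measure S} (hG : ∀ n, P.map (g n) = G)
    (hgi : iIndepFun g P) (hXg : IndepFun (fun ω n => X n ω) (fun ω n => g n ω) P)
    {D : Set (EuclideanSpace ℝ (Fin d) × S)} (hD : MeasurableSet D) {r : ℝ≥0}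
    (hr : ENNReal.ofReal lam * (volume.prod G) D = r) (m : ℕ) :
    P.real {ω | count (fun n ω => (X n ω, g n ω)) D ω = m} = (poissonMeasure r).real {m} := by
  have hGp : IsProbabilityMeasure G := by
    rw [← hG 0]
    exact Measure.isProbabilityMeasure_map (hg 0).aemeasurable
  refine measure_eq_poissonMeasure_of_lintegral_expNeg
    (measurable_count (fun n => (hX.measurable n).prodMk (hg n)) hD) r (fun a ha => ?_) m
  have h := hX.lintegral_expNeg_tsum_marked hg hG hgi hXg
    (φ := D.indicator fun _ => a) (measurable_const.indicator hD)
  have h1 := tsum_indicator_const_eq_count (fun n ω => (X n ω, g n ω)) D a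
  simp_rw [h1] at h
  rw [h]
  congr 1
  have hx : ∀ x, 1 - ∫⁻ y, expNeg (D.indicator (fun _ => a) (x, y)) ∂G =
      (1 - expNeg a) * G (Prod.mk x ⁻¹' D) := by
    intro x
    have hDx : MeasurableSet (Prod.mk x ⁻¹' D) := measurable_prodMk_left hD
    have e1 : ∀ y, expNeg (D.indicator (fun _ => a) (x, y)) =
        1 - (Prod.mk x ⁻¹' D).indicator (fun _ => 1 - expNeg a) y := by
      intro y
      by_cases hy : (x, y) ∈ D
      · rw [Set.indicator_of_mem hy, Set.indicator_of_mem (by exact hy),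
          ENNReal.sub_sub_cancel ENNReal.one_ne_top (expNeg_le_one _)]
      · rw [Set.indicator_of_notMem hy, Set.indicator_of_notMem (by exact hy)]
        simp
    have hle : (1 - expNeg a) * G (Prod.mk x ⁻¹' D) ≤ 1 :=
      mul_le_one' tsub_le_self prob_le_one
    have e2 := lintegral_indicator_const (μ := G) hDx (1 - expNeg a)
    simp_rw [e1]
    rw [lintegral_sub (measurable_const.indicator hDx)
      (e2 ▸ ne_top_of_le_ne_top ENNReal.one_ne_top hle)
      (ae_of_all _ fun y => (Set.indicator_le_self _ _ _).trans tsub_le_self), e2, lintegral_const,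
      measure_univ, mul_one, ENNReal.sub_sub_cancel ENNReal.one_ne_top hle]
  simp_rw [hx]
  rw [lintegral_const_mul _ (measurable_measure_prodMk_left hD), ← Measure.prod_apply hD, ← hr]
  ring

/-- The moments of the `α`-`μ` power-gain law. -/
lemma lintegral_rpow_alphaMuLaw {α μ s δ : ℝ} (hα : 0 < α) (hμ : 0 < μ) (hs : 0 < s) (hδ : 0 ≤ δ) :
    ∫⁻ x, ENNReal.ofReal (x ^ δ) ∂(alphaMuLaw α μ s) =
      ENNReal.ofReal (s ^ δ * Real.Gamma (μ + 2 * δ / α) / Real.Gamma μ) := by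
  have hmeas : Measurable (alphaMuPDF α μ s) := by
    unfold alphaMuPDF
    exact Measurable.ite measurableSet_Ioi (by fun_prop) measurable_const
  rw [alphaMuLaw, lintegral_withDensity_eq_lintegral_mul _ hmeas.ennreal_ofReal (by fun_prop)]
  have hΓ := Real.Gamma_pos_of_pos hμ
  set q := α * μ / 2 - 1 + δ with hq
  set C := α / (2 * s ^ (α * μ / 2) * Real.Gamma μ) with hC
  have hC0 : 0 < C := by positivity
  have hsα : 0 < s ^ (-(α / 2)) := by positivity
  have hq1 : -1 < q := by
    have : 0 < α * μ / 2 := by positivity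
    linarith
  have e1 : ∀ x, ((fun x => ENNReal.ofReal (alphaMuPDF α μ s x)) *
      fun x => ENNReal.ofReal (x ^ δ)) x = (Set.Ioi (0 : ℝ)).indicator
        (fun x => ENNReal.ofReal (C * (x ^ q * Real.exp (-(s ^ (-(α / 2))) * x ^ (α / 2))))) x := by
    intro x
    by_cases hx : 0 < x
    · rw [Set.indicator_of_mem (by exact hx), Pi.mul_apply, alphaMuPDF, if_pos hx,
        ← ENNReal.ofReal_mul (by positivity), Real.div_rpow hx.le hs.le, hq, Real.rpow_add hx,
        Real.rpow_neg hs.le, hC]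
      congr 1
      ring_nf
    · rw [Set.indicator_of_notMem (by exact hx), Pi.mul_apply, alphaMuPDF, if_neg hx]
      simp
  have hI := integral_rpow_mul_exp_neg_mul_rpow (p := α / 2) (by positivity) hq1 hsα
  -- The integral of a non-integrable function is `0` by convention, so a positive value proves
  -- integrability.
  have hint : IntegrableOn
      (fun x : ℝ => x ^ q * Real.exp (-(s ^ (-(α / 2))) * x ^ (α / 2))) (Set.Ioi 0) := by
    by_contra h
    rw [integral_undef h] at hI
    have : 0 < (s ^ (-(α / 2))) ^ (-(q + 1) / (α / 2)) * (1 / (α / 2)) *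
        Real.Gamma ((q + 1) / (α / 2)) := by
      have : 0 < Real.Gamma ((q + 1) / (α / 2)) :=
        Real.Gamma_pos_of_pos (div_pos (by linarith) (by positivity))
      positivity
    exact this.ne hI
  simp_rw [e1]
  rw [lintegral_indicator measurableSet_Ioi, ← ofReal_integral_eq_lintegral_ofReal
    (hint.const_mul C), integral_const_mul, hI]
  · congr 1
    have e2 : (q + 1) / (α / 2) = μ + 2 * δ / α := by
      rw [hq]; field_simp; ring
    have e3 : (s ^ (-(α / 2))) ^ (-(q + 1) / (α / 2)) = s ^ (α * μ / 2) * s ^ δ := by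
      rw [← Real.rpow_mul hs.le, ← Real.rpow_add hs]
      congr 1
      rw [hq]; field_simp; ring
    rw [e2, e3, hC]
    field_simp
  · filter_upwards [ae_restrict_mem measurableSet_Ioi] with x hx
    have : (0 : ℝ) < x := hx
    simp only [Pi.zero_apply]
    positivity

end

/-! ### Path-loss counts and order statistics. -/

section

variable {Ω : Type*} [MeasurableSpace Ω] {P : Measure Ω} [IsProbabilityMeasure P]
  {d : ℕ} {υ lam α μ s : ℝ} {X : ℕ → Ω → EuclideanSpace ℝ (Fin d)} {g : ℕ → Ω → ℝ}

lemma ae_pos_alphaMuLaw (α μ s : ℝ) : ∀ᵐ x ∂(alphaMuLaw α μ s), 0 < x := by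
  rw [ae_iff, alphaMuLaw]
  have : {x : ℝ | ¬ 0 < x} = Set.Iic 0 := by ext; simp
  rw [this, withDensity_apply _ measurableSet_Iic, setLIntegral_congr_fun (g := fun _ => 0)
    measurableSet_Iic]
  · simp
  · intro x hx
    have : ¬ 0 < x := not_lt.2 hx
    simp [alphaMuPDF, this]

/-- The set is a closed ball of radius `(t y) ^ (1 / υ)`; its volume splits into a factor in `t` and
one in `y`. -/
lemma volume_pathLoss_le (hd : 1 ≤ d) (hυ : 0 < υ) {t y : ℝ} (ht : 0 ≤ t) (hy : 0 < y) :
    volume {x : EuclideanSpace ℝ (Fin d) | ‖x‖ ^ υ / y ≤ t} =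
      ENNReal.ofReal (ballConst d * t ^ (d / υ)) * ENNReal.ofReal (y ^ (d / υ)) := by
  have : Nonempty (Fin d) := ⟨⟨0, hd⟩⟩
  have hty : 0 ≤ t * y := by positivity
  have hset : {x : EuclideanSpace ℝ (Fin d) | ‖x‖ ^ υ / y ≤ t} =
      Metric.closedBall 0 ((t * y) ^ υ⁻¹) := by
    ext x
    rw [Set.mem_ofPred_eq, mem_closedBall_zero_iff, div_le_iff₀ hy,
      Real.le_rpow_inv_iff_of_pos (norm_nonneg x) hty hυ]
  have hpow : ((t * y) ^ υ⁻¹) ^ d = t ^ (d / υ) * y ^ (d / υ) := by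
    rw [← Real.rpow_natCast, ← Real.rpow_mul hty, ← Real.mul_rpow ht hy.le]
    ring_nf
  have hπ : √Real.pi ^ d = Real.pi ^ ((d : ℝ) / 2) := by
    rw [Real.sqrt_eq_rpow, ← Real.rpow_natCast, ← Real.rpow_mul Real.pi_pos.le]
    ring_nf
  rw [hset, EuclideanSpace.volume_closedBall, Fintype.card_fin, ← ENNReal.ofReal_pow (by positivity),
    hpow, hπ, ← ENNReal.ofReal_mul (by positivity),
    ← ENNReal.ofReal_mul' (by positivity), ballConst]
  congr 1
  ring_nf

lemma measurable_pathLoss : Measurable fun p : EuclideanSpace ℝ (Fin d) × ℝ => ‖p.1‖ ^ υ / p.2 := by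
  fun_prop

/-- The number of receivers with path loss at most `t` is Poisson distributed. -/
theorem IsReceiverNetwork.measure_encard_pathLoss_le (h : IsReceiverNetwork P lam α μ s X g)
    (hd : 1 ≤ d) (hυ : 0 < υ) (hlam : 0 < lam) (hα : 0 < α) (hμ : 0 < μ) (hs : 0 < s)
    {t : ℝ} (ht : 0 ≤ t) (m : ℕ) :
    P.real {ω | {n | pathLoss υ X g ω n ≤ t}.encard = m} =
      (poissonMeasure (Real.toNNReal (A1 d (d / υ) lam α μ s * t ^ (d / υ)))).real {m} := by
  have hD : MeasurableSet {p : EuclideanSpace ℝ (Fin d) × ℝ | ‖p.1‖ ^ υ / p.2 ≤ t} :=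
    measurable_pathLoss measurableSet_Iic
  refine h.hppp.measure_count_marked h.gain_measurable h.gain_law h.gain_indep
    h.gain_indep_location hD ?_ m
  have hGp : IsProbabilityMeasure (alphaMuLaw α μ s) := by
    rw [← h.gain_law 0]
    exact Measure.isProbabilityMeasure_map (h.gain_measurable 0).aemeasurable
  have hδ : 0 < (d : ℝ) / υ := div_pos (by exact_mod_cast hd) hυ
  -- Slicing by the gain first makes each slice a ball; nonpositive gains are null.
  rw [Measure.prod_apply_symm hD, lintegral_congr_ae (g := fun y =>
    ENNReal.ofReal (ballConst d * t ^ (d / υ)) * ENNReal.ofReal (y ^ (d / υ)))]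
  · rw [lintegral_const_mul _ (by fun_prop), lintegral_rpow_alphaMuLaw hα hμ hs hδ.le]
    have hb : 0 ≤ ballConst d := by unfold ballConst; positivity
    rw [← ENNReal.ofReal_mul (by positivity), ← ENNReal.ofReal_mul hlam.le, ENNReal.ofReal]
    congr 2
    rw [A1, A0]
    field_simp
  · filter_upwards [ae_pos_alphaMuLaw α μ s] with y hy
    exact volume_pathLoss_le hd hυ ht hy

lemma A1_pos (d : ℕ) {δ : ℝ} (hδ : 0 < δ) (hlam : 0 < lam) (hα : 0 < α) (hμ : 0 < μ) (hs : 0 < s) :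
    0 < A1 d δ lam α μ s := by
  have h1 := Real.Gamma_pos_of_pos hμ
  have h2 : 0 < Real.Gamma (μ + 2 * δ / α) := Real.Gamma_pos_of_pos (by positivity)
  have h3 : 0 < ballConst d := by unfold ballConst; positivity
  unfold A1 A0
  positivity

lemma measurable_encard_le (x : ℝ) : Measurable fun ξ : ℕ → ℝ => {n | ξ n ≤ x}.encard :=
  measurable_encard_setOf (A := fun n => {ξ : ℕ → ℝ | ξ n ≤ x}) fun n =>
    measurable_pi_apply n measurableSet_Iic

lemma measurable_kthSmallest (k : ℕ) : Measurable fun ξ : ℕ → ℝ => kthSmallest ξ k := by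
  have hS : ∀ x : ℝ, MeasurableSet {ξ : ℕ → ℝ | (k : ℕ∞) ≤ {n | ξ n ≤ x}.encard} := fun x =>
    measurable_encard_le x (MeasurableSet.of_discrete (s := Set.Ici (k : ℕ∞)))
  have hup : ∀ (ξ : ℕ → ℝ) {x y : ℝ}, x ≤ y → (k : ℕ∞) ≤ {n | ξ n ≤ x}.encard →
      (k : ℕ∞) ≤ {n | ξ n ≤ y}.encard := fun ξ x y hxy h =>
    h.trans (Set.encard_le_encard fun n (hn : ξ n ≤ x) => hn.trans hxy)
  have hne : ∀ ξ : ℕ → ℝ, {x : ℝ | (k : ℕ∞) ≤ {n | ξ n ≤ x}.encard}.Nonempty := by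
    intro ξ
    obtain ⟨M, hM⟩ := ((Finset.range k).image ξ).bddAbove
    refine ⟨M, natCast_le_encard_iff.2 ⟨Finset.range k, Finset.card_range k, fun n hn => ?_⟩⟩
    exact hM (Finset.mem_coe.2 (Finset.mem_image_of_mem ξ hn))
  have hbdd : ∀ ξ : ℕ → ℝ, BddBelow {x : ℝ | (k : ℕ∞) ≤ {n | ξ n ≤ x}.encard} ↔
      ∃ q : ℤ, ¬ (k : ℕ∞) ≤ {n | ξ n ≤ (q : ℝ)}.encard := by
    intro ξ
    constructor
    · rintro ⟨b, hb⟩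
      obtain ⟨q, hq⟩ := exists_int_lt b
      exact ⟨q, fun h => hq.not_ge (hb h)⟩
    · rintro ⟨q, hq⟩
      exact ⟨q, fun x hx => le_of_not_ge fun hxq => hq (hup ξ hxq hx)⟩
  have hB : MeasurableSet {ξ : ℕ → ℝ | ∃ q : ℤ, ¬ (k : ℕ∞) ≤ {n | ξ n ≤ (q : ℝ)}.encard} := by
    rw [Set.ofPred_exists]
    exact MeasurableSet.iUnion fun q => (hS q).compl
  refine measurable_of_Iio fun c => ?_
  have hU : MeasurableSet {ξ : ℕ → ℝ | ∃ q : ℚ, (q : ℝ) < c ∧ (k : ℕ∞) ≤ {n | ξ n ≤ (q : ℝ)}.encard} := by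
    rw [Set.ofPred_exists]
    refine MeasurableSet.iUnion fun q => ?_
    by_cases hq : (q : ℝ) < c
    · simpa [hq] using hS q
    · simp [hq]
  -- Levels that suffice are upward closed, so rational ones detect the infimum. If they are
  -- unbounded below, `sInf` is `0` by default, whence the condition `0 < c`.
  have : (fun ξ : ℕ → ℝ => kthSmallest ξ k) ⁻¹' Set.Iio c =
      ({ξ | ∃ q : ℤ, ¬ (k : ℕ∞) ≤ {n | ξ n ≤ (q : ℝ)}.encard} ∩
        {ξ | ∃ q : ℚ, (q : ℝ) < c ∧ (k : ℕ∞) ≤ {n | ξ n ≤ (q : ℝ)}.encard}) ∪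
      ({ξ | ∃ q : ℤ, ¬ (k : ℕ∞) ≤ {n | ξ n ≤ (q : ℝ)}.encard}ᶜ ∩ {_ξ | 0 < c}) := by
    ext ξ
    simp only [Set.mem_preimage, Set.mem_Iio, Set.mem_union, Set.mem_inter_iff, Set.mem_ofPred_eq,
      Set.mem_compl_iff, ← hbdd]
    by_cases hb : BddBelow {x : ℝ | (k : ℕ∞) ≤ {n | ξ n ≤ x}.encard}
    · simp only [hb, true_and, not_true_eq_false, false_and, or_false]
      rw [kthSmallest, csInf_lt_iff hb (hne ξ)]
      constructor
      · rintro ⟨x, hx, hxc⟩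
        obtain ⟨q, hq1, hq2⟩ := exists_rat_btwn hxc
        exact ⟨q, hq2, hup ξ hq1.le hx⟩
      · rintro ⟨q, hq1, hq2⟩
        exact ⟨q, hq2, hq1⟩
    · simp [hb, kthSmallest]
  rw [this]
  exact (hB.inter hU).union (hB.compl.inter (MeasurableSet.const _))

/-- Holds at the endpoint too because the infimum is attained; it converts the distribution of an
order statistic into a Poisson tail. -/
lemma kthSmallest_le_iff {ξ : ℕ → ℝ} (hfin : ∀ x, {n | ξ n ≤ x}.Finite) {k : ℕ} (hk : 1 ≤ k)
    (x : ℝ) : kthSmallest ξ k ≤ x ↔ (k : ℕ∞) ≤ {n | ξ n ≤ x}.encard := by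
  obtain ⟨n, hn, hlt, hle⟩ := kthSmallest_spec ξ hfin k hk
  rw [← hn]
  constructor
  · exact fun h => hle.trans (Set.encard_le_encard fun m (hm : ξ m ≤ ξ n) => hm.trans h)
  · intro h
    by_contra! hx
    exact (h.trans (Set.encard_le_encard fun m (hm : ξ m ≤ x) => hm.trans_lt hx)).not_gt hlt

lemma ae_ne_top_of_measure_eq_poissonMeasure {N : Ω → ℕ∞} (hN : Measurable N) {r : ℝ≥0}
    (h : ∀ m : ℕ, P.real {ω | N ω = m} = (poissonMeasure r).real {m}) : ∀ᵐ ω ∂P, N ω ≠ ⊤ := by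
  have hc : Measurable (fun m : ℕ => (m : ℕ∞)) := measurable_of_countable _
  have hmap := map_eq_of_measure_natCast (ν := poissonMeasure r) hN fun m =>
    (measureReal_eq_measureReal_iff).1 (h m)
  have : ∀ᵐ x ∂(P.map N), x ≠ ⊤ := by
    rw [hmap, ae_map_iff hc.aemeasurable (MeasurableSet.of_discrete)]
    simp
  exact ae_of_ae_map hN.aemeasurable this

lemma measure_natCast_le {N : Ω → ℕ∞} (hN : Measurable N) {r : ℝ≥0}
    (h : ∀ m : ℕ, P.real {ω | N ω = m} = (poissonMeasure r).real {m}) (k : ℕ) :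
    P.real {ω | (k : ℕ∞) ≤ N ω} =
      1 - ∑ i ∈ Finset.range k, Real.exp (-r) * r ^ i / (i.factorial : ℝ) := by
  have hs : {ω | (k : ℕ∞) ≤ N ω} = (⋃ i ∈ Finset.range k, {ω | N ω = (i : ℕ)})ᶜ := by
    ext ω
    simp only [Set.mem_ofPred_eq, Set.mem_compl_iff, Set.mem_iUnion, Finset.mem_range, exists_prop,
      not_exists, not_and]
    constructor
    · intro hk i hi hN
      rw [hN] at hk
      exact absurd (by exact_mod_cast hk) (not_le.2 hi)
    · intro hk
      by_contra! hlt
      obtain ⟨i, hi⟩ := ENat.ne_top_iff_exists.1 hlt.ne_top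
      rw [← hi] at hlt
      exact hk i (by exact_mod_cast hlt) hi.symm
  have hm : ∀ i : ℕ, MeasurableSet {ω | N ω = (i : ℕ)} := fun i => hN (measurableSet_singleton _)
  rw [hs, probReal_compl_eq_one_sub (Finset.measurableSet_biUnion _ fun i _ => hm i),
    measureReal_biUnion_finset ?_ fun i _ => hm i]
  · simp_rw [h, poissonMeasure_real_singleton]
  · intro i _ j _ hij
    refine Set.disjoint_left.2 fun ω hi hj => hij ?_
    have : (i : ℕ∞) = j := (show N ω = i from hi).symm.trans hj
    exact_mod_cast this

end

/-! ### Erlang against exponential, and the laws of the scaled path losses. -/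

section

lemma integral_pow_mul_exp_neg_mul {b : ℝ} (hb : 0 < b) (i : ℕ) :
    ∫ x in Set.Ioi (0 : ℝ), x ^ i * Real.exp (-(b * x)) = i.factorial / b ^ (i + 1) := by
  have h := Real.integral_rpow_mul_exp_neg_mul_Ioi (a := i + 1) (by positivity) hb
  simp only [add_sub_cancel_right, Real.rpow_natCast] at h
  rw [h, Real.Gamma_nat_eq_factorial]
  have : (1 / b) ^ ((i : ℝ) + 1) = (1 / b) ^ (i + 1) := by
    rw [← Real.rpow_natCast]; push_cast; rfl
  rw [this, one_div, inv_pow, div_eq_inv_mul]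

lemma integrableOn_pow_mul_exp_neg_mul {b : ℝ} (hb : 0 < b) (i : ℕ) :
    IntegrableOn (fun x : ℝ => x ^ i * Real.exp (-(b * x))) (Set.Ioi 0) := by
  by_contra h
  have h1 := integral_pow_mul_exp_neg_mul hb i
  rw [integral_undef h] at h1
  have : 0 < (i.factorial : ℝ) / b ^ (i + 1) := by positivity
  exact this.ne h1

lemma integral_exp_neg_mul_poisson_tail {c : ℝ} (hc : 0 < c) (k : ℕ) :
    ∫ x in Set.Ioi (0 : ℝ), Real.exp (-x) *
      (1 - ∑ i ∈ Finset.range k, Real.exp (-(c * x)) * (c * x) ^ i / (i.factorial : ℝ)) =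
      (c / (1 + c)) ^ k := by
  have h1 : ∀ x : ℝ, Real.exp (-x) *
      (1 - ∑ i ∈ Finset.range k, Real.exp (-(c * x)) * (c * x) ^ i / (i.factorial : ℝ)) =
      x ^ 0 * Real.exp (-(1 * x)) - ∑ i ∈ Finset.range k,
        c ^ i / (i.factorial : ℝ) * (x ^ i * Real.exp (-((1 + c) * x))) := by
    intro x
    rw [mul_sub, Finset.mul_sum]
    congr 1
    · simp
    · refine Finset.sum_congr rfl fun i _ => ?_
      rw [add_mul, one_mul, neg_add, Real.exp_add, mul_pow]
      ring
  have hc1 : 0 < 1 + c := by linarith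
  have hint : ∀ i, IntegrableOn (fun x : ℝ =>
      c ^ i / (i.factorial : ℝ) * (x ^ i * Real.exp (-((1 + c) * x)))) (Set.Ioi 0) :=
    fun i => (integrableOn_pow_mul_exp_neg_mul hc1 i).const_mul _
  simp_rw [h1]
  rw [integral_sub (integrableOn_pow_mul_exp_neg_mul one_pos 0)
    (integrable_finsetSum _ fun i _ => hint i), integral_finsetSum _ fun i _ => hint i]
  simp_rw [integral_const_mul]
  rw [integral_pow_mul_exp_neg_mul one_pos]
  simp_rw [integral_pow_mul_exp_neg_mul hc1]
  clear h1
  -- The new term is `c ^ k / (1 + c) ^ (k + 1)`, that is `(c / (1 + c)) ^ k` times `1 - c / (1 +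
  -- c)`.
  induction k with
  | zero => simp
  | succ k ih =>
    rw [Finset.sum_range_succ, ← sub_sub, ih, div_pow, div_pow]
    field_simp
    ring

variable {Ω : Type*} [MeasurableSpace Ω] {P : Measure Ω}

variable {d : ℕ} {υ lam α μ s : ℝ} {X : ℕ → Ω → EuclideanSpace ℝ (Fin d)} {g : ℕ → Ω → ℝ}

/-- The path loss of the `k`-th best receiver as a function of the receivers. -/
def kthPathLoss (d : ℕ) (υ : ℝ) (k : ℕ) (p : ℕ → EuclideanSpace ℝ (Fin d) × ℝ) : ℝ :=
  kthSmallest (fun n => ‖(p n).1‖ ^ υ / (p n).2) k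

lemma measurable_kthPathLoss (k : ℕ) : Measurable (kthPathLoss d υ k) :=
  (measurable_kthSmallest k).comp
    (measurable_pi_lambda _ fun n => measurable_pathLoss.comp (measurable_pi_apply n))

namespace IsReceiverNetwork

lemma measurable_receivers (h : IsReceiverNetwork P lam α μ s X g) :
    Measurable fun ω n => (X n ω, g n ω) :=
  measurable_pi_lambda _ fun n => (h.hppp.measurable n).prodMk (h.gain_measurable n)

lemma measurable_kthSmallest_pathLoss (h : IsReceiverNetwork P lam α μ s X g) (k : ℕ) :
    Measurable fun ω => kthSmallest (pathLoss υ X g ω) k := by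
  have h1 : Measurable fun ω => kthPathLoss d υ k fun n => (X n ω, g n ω) :=
    (measurable_kthPathLoss k).comp h.measurable_receivers
  have h2 : ∀ ω, pathLoss υ X g ω = fun n => ‖X n ω‖ ^ υ / g n ω := fun _ => rfl
  simp_rw [h2]
  exact h1

lemma measurable_encard_pathLoss_le (h : IsReceiverNetwork P lam α μ s X g) (t : ℝ) :
    Measurable fun ω => {n | pathLoss υ X g ω n ≤ t}.encard := by
  have h1 : ∀ n, Measurable fun ω => ‖X n ω‖ ^ υ / g n ω := fun n =>
    ((h.hppp.measurable n).norm.pow_const υ).div (h.gain_measurable n)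
  exact measurable_encard_setOf (A := fun n => {ω | ‖X n ω‖ ^ υ / g n ω ≤ t})
    fun n => h1 n measurableSet_Iic

end IsReceiverNetwork

variable [IsProbabilityMeasure P]

/-- The probability that an Erlang variable is at most `c` times an independent exponential one. -/
theorem measureReal_erlang_le_mul_exp {T S : Ω → ℝ} (hT : Measurable T) (hS : Measurable S)
    (hTS : IndepFun T S P) {k : ℕ}
    (hTl : ∀ t, 0 ≤ t → P.real {ω | T ω ≤ t} =
      1 - ∑ i ∈ Finset.range k, Real.exp (-t) * t ^ i / (i.factorial : ℝ))
    (hSl : P.map S = expMeasure 1) {c : ℝ} (hc : 0 < c) :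
    P.real {ω | T ω ≤ c * S ω} = (c / (1 + c)) ^ k := by
  have hexp : IsProbabilityMeasure (expMeasure 1) := isProbabilityMeasure_expMeasure one_pos
  have hTp : IsProbabilityMeasure (P.map T) := Measure.isProbabilityMeasure_map hT.aemeasurable
  have hjoint := (indepFun_iff_map_prod_eq_prod_map_map hT.aemeasurable hS.aemeasurable).1 hTS
  have hD : MeasurableSet {p : ℝ × ℝ | p.1 ≤ c * p.2} :=
    measurableSet_le measurable_fst (measurable_snd.const_mul c)
  have h1 : P {ω | T ω ≤ c * S ω} = ∫⁻ y, P.map T (Set.Iic (c * y)) ∂(expMeasure 1) := by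
    have : {ω | T ω ≤ c * S ω} = (fun ω => (T ω, S ω)) ⁻¹' {p : ℝ × ℝ | p.1 ≤ c * p.2} := rfl
    rw [this, ← Measure.map_apply (hT.prodMk hS) hD, hjoint, Measure.prod_apply_symm hD, hSl]
    rfl
  have hmeas : Measurable fun y => P.map T (Set.Iic (c * y)) :=
    measurable_measure_prodMk_right hD
  have hpdf : expMeasure 1 = volume.withDensity
    fun x => ENNReal.ofReal (exponentialPDFReal 1 x) := rfl
  rw [measureReal_def, h1, ← integral_toReal hmeas.aemeasurable
    (ae_of_all _ fun y => measure_lt_top _ _), hpdf, integral_withDensity_eq_integral_toReal_smul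
    (measurable_exponentialPDFReal 1).ennreal_ofReal (ae_of_all _ fun y => ENNReal.ofReal_lt_top),
    ← integral_exp_neg_mul_poisson_tail hc k, ← integral_indicator measurableSet_Ioi]
  refine integral_congr_ae ?_
  -- At `y = 0` the exponential density is `1` but the indicator of `Ioi 0` vanishes.
  have h0 : ∀ᵐ y : ℝ, y ≠ 0 := by simp [ae_iff]
  filter_upwards [h0] with y hy
  rcases lt_or_gt_of_ne hy with hy | hy
  · rw [← exponentialPDF, exponentialPDF_of_neg hy, Set.indicator_of_notMem (by simpa using hy.le)]
    simp
  · rw [← exponentialPDF, exponentialPDF_of_nonneg hy.le, Set.indicator_of_mem (by exact hy), one_mul, one_mul,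
      ENNReal.toReal_ofReal (Real.exp_pos _).le, smul_eq_mul, ← hTl _ (by positivity),
      Measure.map_apply hT measurableSet_Iic]
    rfl

/-- Given `T`, a tie pins `S` to a single point, which is null because `S` has a density. -/
lemma measure_eq_mul_exp_eq_zero {T S : Ω → ℝ} (hT : Measurable T) (hS : Measurable S)
    (hTS : IndepFun T S P) (hSl : P.map S = expMeasure 1) {c : ℝ} (hc : 0 < c) :
    P {ω | T ω = c * S ω} = 0 := by
  have hjoint := (indepFun_iff_map_prod_eq_prod_map_map hT.aemeasurable hS.aemeasurable).1 hTS
  have hD : MeasurableSet {p : ℝ × ℝ | p.1 = c * p.2} :=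
    measurableSet_eq_fun measurable_fst (measurable_snd.const_mul c)
  have hexp : IsProbabilityMeasure (expMeasure 1) := isProbabilityMeasure_expMeasure one_pos
  have : {ω | T ω = c * S ω} = (fun ω => (T ω, S ω)) ⁻¹' {p : ℝ × ℝ | p.1 = c * p.2} := rfl
  rw [this, ← Measure.map_apply (hT.prodMk hS) hD, hjoint, hSl, Measure.prod_apply hD]
  refine lintegral_eq_zero_of_ae_eq_zero (ae_of_all _ fun x => ?_)
  have hx : Prod.mk x ⁻¹' {p : ℝ × ℝ | p.1 = c * p.2} = {x / c} := by
    ext y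
    simp only [Set.mem_preimage, Set.mem_ofPred_eq, Set.mem_singleton_iff, eq_div_iff hc.ne']
    rw [mul_comm c, eq_comm]
  simp only [hx, Pi.zero_apply]
  exact withDensity_absolutelyContinuous (μ := volume) (exponentialPDF 1) Real.volume_singleton

namespace IsReceiverNetwork

variable (h : IsReceiverNetwork P lam α μ s X g) (hd : 1 ≤ d) (hυ : 0 < υ) (hlam : 0 < lam)
  (hα : 0 < α) (hμ : 0 < μ) (hs : 0 < s)

include h hd hυ hlam hα hμ hs

lemma ae_finite_pathLoss_le : ∀ᵐ ω ∂P, ∀ x, {n | pathLoss υ X g ω n ≤ x}.Finite := by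
  have h1 : ∀ᵐ ω ∂P, ∀ N : ℕ, {n | pathLoss υ X g ω n ≤ (N : ℝ)}.encard ≠ ⊤ :=
    ae_all_iff.2 fun N => ae_ne_top_of_measure_eq_poissonMeasure (h.measurable_encard_pathLoss_le _)
      fun m => h.measure_encard_pathLoss_le hd hυ hlam hα hμ hs N.cast_nonneg m
  filter_upwards [h1] with ω hω x
  obtain ⟨N, hN⟩ := exists_nat_ge x
  exact (Set.encard_ne_top_iff.1 (hω N)).subset fun n hn => le_trans hn hN

lemma measureReal_kthSmallest_le {k : ℕ} (hk : 1 ≤ k) {t : ℝ} (ht : 0 ≤ t) :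
    P.real {ω | kthSmallest (pathLoss υ X g ω) k ≤ t} =
      1 - ∑ i ∈ Finset.range k, Real.exp (-(A1 d (d / υ) lam α μ s * t ^ (d / υ))) *
        (A1 d (d / υ) lam α μ s * t ^ (d / υ)) ^ i / (i.factorial : ℝ) := by
  have hA := A1_pos (lam := lam) (α := α) (μ := μ) (s := s) d
    (δ := d / υ) (div_pos (by exact_mod_cast hd) hυ) hlam hα hμ hs
  have h2 := measure_natCast_le (h.measurable_encard_pathLoss_le t)
    (h.measure_encard_pathLoss_le hd hυ hlam hα hμ hs ht) k
  rw [Real.coe_toNNReal _ (by positivity)] at h2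
  rw [← h2]
  refine measureReal_congr ?_
  filter_upwards [h.ae_finite_pathLoss_le hd hυ hlam hα hμ hs] with ω hω
  exact propext (kthSmallest_le_iff hω hk t)

/-- At `t = 0` the Poisson mean is zero, so only the term `i = 0` survives and cancels the `1`. -/
lemma ae_kthSmallest_pos {k : ℕ} (hk : 1 ≤ k) :
    ∀ᵐ ω ∂P, 0 < kthSmallest (pathLoss υ X g ω) k := by
  have h1 := h.measureReal_kthSmallest_le hd hυ hlam hα hμ hs hk le_rfl
  have hδ : (d : ℝ) / υ ≠ 0 := (div_pos (by exact_mod_cast hd) hυ).ne'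
  rw [Real.zero_rpow hδ, mul_zero, Finset.sum_eq_single 0 (fun i _ hi => by simp [hi])
    (fun h0 => absurd (Finset.mem_range.2 hk) h0)] at h1
  simp only [neg_zero, Real.exp_zero, pow_zero, mul_one, Nat.factorial_zero, Nat.cast_one, div_one,
    sub_self] at h1
  rw [ae_iff]
  simpa [measureReal_eq_zero_iff] using h1

/-- The scaled path loss of the `k`-th best receiver has the Erlang distribution function. -/
lemma measureReal_mul_kthSmallest_rpow_le {k : ℕ} (hk : 1 ≤ k) {t : ℝ} (ht : 0 ≤ t) :
    P.real {ω | A1 d (d / υ) lam α μ s * kthSmallest (pathLoss υ X g ω) k ^ (d / υ) ≤ t} =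
      1 - ∑ i ∈ Finset.range k, Real.exp (-t) * t ^ i / (i.factorial : ℝ) := by
  have hδ : 0 < (d : ℝ) / υ := div_pos (by exact_mod_cast hd) hυ
  have hA := A1_pos (lam := lam) (α := α) (μ := μ) (s := s) d hδ hlam hα hμ hs
  set A := A1 d (d / υ) lam α μ s
  -- The level `(t / A) ^ (1 / δ)` solves `A x ^ δ = t`.
  have hu : A * ((t / A) ^ ((d : ℝ) / υ)⁻¹) ^ ((d : ℝ) / υ) = t := by
    rw [Real.rpow_inv_rpow (by positivity) hδ.ne']
    field_simp
  have h1 := h.measureReal_kthSmallest_le hd hυ hlam hα hμ hs hk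
    (t := (t / A) ^ ((d : ℝ) / υ)⁻¹) (by positivity)
  rw [hu] at h1
  rw [← h1]
  refine measureReal_congr ?_
  filter_upwards [h.ae_kthSmallest_pos hd hυ hlam hα hμ hs hk] with ω hω
  refine propext (show A * _ ≤ t ↔ kthSmallest (pathLoss υ X g ω) k ≤ _ from ?_)
  rw [Real.le_rpow_inv_iff_of_pos hω.le (by positivity) hδ, le_div_iff₀ hA, mul_comm]

lemma map_mul_kthSmallest_one_rpow :
    P.map (fun ω => A1 d (d / υ) lam α μ s * kthSmallest (pathLoss υ X g ω) 1 ^ (d / υ)) =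
      expMeasure 1 := by
  have hexp : IsProbabilityMeasure (expMeasure 1) := isProbabilityMeasure_expMeasure one_pos
  have hm : Measurable fun ω =>
      A1 d (d / υ) lam α μ s * kthSmallest (pathLoss υ X g ω) 1 ^ ((d : ℝ) / υ) :=
    ((h.measurable_kthSmallest_pathLoss 1).pow_const _).const_mul _
  have := Measure.isProbabilityMeasure_map (μ := P) hm.aemeasurable
  refine Measure.eq_of_cdf _ _ (StieltjesFunction.ext fun x => ?_)
  rw [cdf_expMeasure_eq one_pos, cdf_eq_real, map_measureReal_apply hm measurableSet_Iic]
  have hset : (fun ω => A1 d (d / υ) lam α μ s * kthSmallest (pathLoss υ X g ω) 1 ^ ((d : ℝ) / υ)) ⁻¹'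
      Set.Iic x = {ω | A1 d (d / υ) lam α μ s *
        kthSmallest (pathLoss υ X g ω) 1 ^ ((d : ℝ) / υ) ≤ x} := rfl
  rw [hset]
  split_ifs with hx
  · rw [h.measureReal_mul_kthSmallest_rpow_le hd hυ hlam hα hμ hs le_rfl hx]
    simp
  · rw [measureReal_eq_zero_iff, measure_eq_zero_iff_ae_notMem]
    filter_upwards [h.ae_kthSmallest_pos hd hυ hlam hα hμ hs le_rfl] with ω hω
    have hδ : 0 < (d : ℝ) / υ := div_pos (by exact_mod_cast hd) hυ
    have hA := A1_pos (lam := lam) (α := α) (μ := μ) (s := s) d hδ hlam hα hμ hs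
    have : 0 < A1 d (d / υ) lam α μ s * kthSmallest (pathLoss υ X g ω) 1 ^ ((d : ℝ) / υ) := by
      positivity
    exact not_le.2 (by linarith)

end IsReceiverNetwork

lemma secrecyCapacity_pos_iff {γb γe : ℝ} (hb : 0 < γb) (he : 0 < γe) :
    0 < secrecyCapacity γb γe ↔ γe < γb := by
  rw [secrecyCapacity, lt_max_iff, or_iff_left (lt_irrefl _), sub_pos,
    Real.logb_lt_logb_iff (by norm_num) (by linarith) (by linarith)]
  exact add_lt_add_iff_left 1

end

end SecrecyNetwork

end

/-! ### The secrecy probability. -/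

theorem mainTheorem4
    {Ω : Type*} [MeasurableSpace Ω] (P : MeasureTheory.Measure Ω)
    [MeasureTheory.IsProbabilityMeasure P]
    (d : ℕ) (hd : 1 ≤ d) (υ : ℝ) (hυ : 0 < υ)
    (lamb lame : ℝ) (hlamb : 0 < lamb) (hlame : 0 < lame)
    (αb μb sb αe μe se : ℝ) (hαb : 0 < αb) (hμb : 0 < μb) (hsb : 0 < sb)
    (hαe : 0 < αe) (hμe : 0 < μe) (hse : 0 < se)
    (ηb ηe : ℝ) (hηb : 0 < ηb) (hηe : 0 < ηe)
    (Xb Xe : ℕ → Ω → EuclideanSpace ℝ (Fin d)) (gb ge : ℕ → Ω → ℝ)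
    (hb : SecrecyNetwork.IsReceiverNetwork P lamb αb μb sb Xb gb)
    (he : SecrecyNetwork.IsReceiverNetwork P lame αe μe se Xe ge)
    (hbe : ProbabilityTheory.IndepFun
      (fun ω n => (Xb n ω, gb n ω)) (fun ω n => (Xe n ω, ge n ω)) P)
    (k : ℕ) (hk : 1 ≤ k)
    (δ ϖ Ab1 Ae1 : ℝ) (hδ : δ = d / υ) (hϖ : ϖ = ηb / ηe)
    (hAb1 : Ab1 = SecrecyNetwork.A1 d δ lamb αb μb sb)
    (hAe1 : Ae1 = SecrecyNetwork.A1 d δ lame αe μe se) :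
    P.real {ω | SecrecyNetwork.kthBestSNR ηe υ Xe ge 1 ω <
        SecrecyNetwork.kthBestSNR ηb υ Xb gb k ω} =
      (Ab1 / (Ab1 + Ae1 * ϖ ^ (-δ))) ^ k ∧
    P.real {ω | 0 < SecrecyNetwork.secrecyCapacity
        (SecrecyNetwork.kthBestSNR ηb υ Xb gb k ω)
        (SecrecyNetwork.kthBestSNR ηe υ Xe ge 1 ω)} =
      (Ab1 / (Ab1 + Ae1 * ϖ ^ (-δ))) ^ k := by
  have hd0 : 0 < (d : ℝ) := by exact_mod_cast hd
  have hδ0 : 0 < (d : ℝ) / υ := div_pos hd0 hυ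
  have hAb := SecrecyNetwork.A1_pos (lam := lamb) (α := αb) (μ := μb) (s := sb) d hδ0 hlamb hαb hμb hsb
  have hAe := SecrecyNetwork.A1_pos (lam := lame) (α := αe) (μ := μe) (s := se) d hδ0 hlame hαe hμe hse
  subst hδ hAb1 hAe1
  have hϖ0 : 0 < ϖ := by rw [hϖ]; positivity
  set Ab := SecrecyNetwork.A1 d (d / υ) lamb αb μb sb with hAbdef
  set Ae := SecrecyNetwork.A1 d (d / υ) lame αe μe se with hAedef
  set Kb : Ω → ℝ := fun ω => SecrecyNetwork.kthSmallest (SecrecyNetwork.pathLoss υ Xb gb ω) k with hKb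
  set Ke : Ω → ℝ := fun ω => SecrecyNetwork.kthSmallest (SecrecyNetwork.pathLoss υ Xe ge ω) 1 with hKe
  -- Chosen so that `T ≤ c S` reads `ξ_k ^ δ ≤ (ϖ ξ_e) ^ δ`.
  set c := Ab * ϖ ^ ((d : ℝ) / υ) / Ae with hc
  have hc0 : 0 < c := by positivity
  have hTm : Measurable fun ω => Ab * Kb ω ^ ((d : ℝ) / υ) :=
    ((hb.measurable_kthSmallest_pathLoss k).pow_const _).const_mul _
  have hSm : Measurable fun ω => Ae * Ke ω ^ ((d : ℝ) / υ) :=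
    ((he.measurable_kthSmallest_pathLoss 1).pow_const _).const_mul _
  have hind : IndepFun (fun ω => Ab * Kb ω ^ ((d : ℝ) / υ)) (fun ω => Ae * Ke ω ^ ((d : ℝ) / υ)) P :=
    hbe.comp (((SecrecyNetwork.measurable_kthPathLoss (υ := υ) k).pow_const ((d : ℝ) / υ)).const_mul Ab)
      (((SecrecyNetwork.measurable_kthPathLoss (υ := υ) 1).pow_const ((d : ℝ) / υ)).const_mul Ae)
  have hSl := he.map_mul_kthSmallest_one_rpow hd hυ hlame hαe hμe hse
  have hle := SecrecyNetwork.measureReal_erlang_le_mul_exp hTm hSm hind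
    (fun t ht => hb.measureReal_mul_kthSmallest_rpow_le hd hυ hlamb hαb hμb hsb hk ht) hSl hc0
  -- Ties are null, so the weak inequality given by distribution functions may replace the strict
  -- one between signal-to-noise ratios.
  have hne := measure_eq_zero_iff_ae_notMem.1
    (SecrecyNetwork.measure_eq_mul_exp_eq_zero hTm hSm hind hSl hc0)
  have hval : c / (1 + c) = Ab / (Ab + Ae * ϖ ^ (-((d : ℝ) / υ))) := by
    rw [hc, Real.rpow_neg hϖ0.le]
    have : 0 < ϖ ^ ((d : ℝ) / υ) := by positivity
    field_simp
    ring
  have hbpos := hb.ae_kthSmallest_pos hd hυ hlamb hαb hμb hsb hk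
  have hepos := he.ae_kthSmallest_pos hd hυ hlame hαe hμe hse le_rfl
  have hsnr : P.real {ω | SecrecyNetwork.kthBestSNR ηe υ Xe ge 1 ω <
      SecrecyNetwork.kthBestSNR ηb υ Xb gb k ω} = (Ab / (Ab + Ae * ϖ ^ (-((d : ℝ) / υ)))) ^ k := by
    rw [← hval, ← hle]
    refine measureReal_congr ?_
    filter_upwards [hbpos, hepos, hne] with ω hKb0 hKe0 hω
    refine propext (show ηe / Ke ω < ηb / Kb ω ↔
      Ab * Kb ω ^ ((d : ℝ) / υ) ≤ c * (Ae * Ke ω ^ ((d : ℝ) / υ)) from ?_)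
    have hω' : Ab * Kb ω ^ ((d : ℝ) / υ) ≠ c * (Ae * Ke ω ^ ((d : ℝ) / υ)) := hω
    have hKb0' : 0 < Kb ω := hKb0
    have hKe0' : 0 < Ke ω := hKe0
    have e1 : c * (Ae * Ke ω ^ ((d : ℝ) / υ)) = Ab * (ϖ * Ke ω) ^ ((d : ℝ) / υ) := by
      rw [hc, Real.mul_rpow hϖ0.le hKe0'.le]
      field_simp
    rw [hω'.le_iff_lt, e1, mul_lt_mul_iff_right₀ hAb,
      Real.rpow_lt_rpow_iff hKb0'.le (by positivity) hδ0, div_lt_div_iff₀ hKe0' hKb0', hϖ,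
      div_mul_eq_mul_div, lt_div_iff₀ hηe, mul_comm (Kb ω)]
  refine ⟨hsnr, hsnr ▸ measureReal_congr ?_⟩
  filter_upwards [hbpos, hepos] with ω hKb0 hKe0
  exact propext (SecrecyNetwork.secrecyCapacity_pos_iff (div_pos hηb hKb0) (div_pos hηe hKe0))
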